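/- \textbf{Theorem (High-Rate High-Consumption Code).} A Steiner $2$-design $S(2,\mu,v)$ consists of a set $V$ of $v$ points and a family $\mathcal B$ of $\mu$-subsets of $V$ (blocks) such that any two distinct points lie together in exactly one block; it is non-trivial if $2\le\mu<v$. Its point-by-block incidence matrix $H$ is the $v\times|\mathcal B|$ matrix over $\mathbb F_2$ whose rows are indexed by points and columns by blocks, with entry $1$ exactly when the point lies in the block. All matrix operations are over $\mathbb F_2$. An $[[n,k;c]]$ entanglement-assisted quantum error-correcting code (EAQECC) is a subspace $C$ of the space of $n+c$ qubits ($n$ physical qubits and $c$ qubits of the receiver) of the form $C=\{(E\otimes 1)(\psi\otimes\Phi^{\otimes c}) : \psi\in(\mathbb C^2)^{\otimes k}\}$, where $\Phi=(|00\rangle+|11\rangle)/\sqrt2$, the factor $1$ acts on the receiver's halves of the $c$ copies of $\Phi$, and $E:(\mathbb C^2)^{\otimes(k+c)}\to(\mathbb C^2)^{\otimes n}$ is a linear isometry. It corresponds to a binary matrix $H$ with $n$ columns and rows $h_p$ (CSS construction) if there are vectors $a_p,b_p\in\mathbb F_2^c$ such that the operators $X^{h_p}\otimes X^{a_p}$ and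 $Z^{h_p}\otimes Z^{b_p}$ all commute and $C$ is the space of all vectors fixed by all of them. Let $H$ be a point-by-block incidence matrix of a non-trivial $S(2,\mu,v)$, and suppose that $r=\frac{v-1}{\mu-1}$ is an even integer. Then every row of $H$ has weight $r$, every column has weight $\mu$, the Tanner graph of $H$ (the bipartite graph on the rows and columns of $H$ whose edges are the entries equal to $1$) has girth $6$, and $HH^T=J-I$ over $\mathbb F_2$, where $J$ is the all-one matrix. Moreover, there is an EAQECC corresponding to $H$, and every $[[n,k;c]]$ EAQECC corresponding to $H$ satisfies \[ n=\frac{v(v-1)}{\mu(\mu-1)},\qquad c=v-1, \] \[ k=\frac{vr}{\mu}-v+1 \ \text{ if } \mu \text{ is even},\qquad k\in\Bigl\{\frac{vr}{\mu}-v+1,\ \frac{vr}{\mu}-v-1\Bigr\}\ \text{ if } \mu \text{ is odd}. \] -/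

import Mathlib

open Matrix

noncomputable section

/-! ### Designs and incidence matrices -/

/-- The point-by-block incidence matrix over `𝔽₂` of the incidence structure with point set `V`
and family of blocks `blk : β → Finset V`. -/
def incidenceMatrix {V β : Type*} [DecidableEq V] (blk : β → Finset V) : Matrix V β (ZMod 2) :=
  Matrix.of fun p b => if p ∈ blk b then 1 else 0

/-- `(V, blk)` is a 2-`(v, μ, lam)` design. -/
structure Is2Design {V β : Type*} [Fintype V] [DecidableEq V] [Fintype β]
    (blk : β → Finset V) (v μ lam : ℕ) : Prop where
  card_points : Fintype.card V = v
  card_block : ∀ b, (blk b).card = μ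
  card_pair : ∀ p q : V, p ≠ q →
    (Finset.univ.filter fun b => p ∈ blk b ∧ q ∈ blk b).card = lam

/-- `(V, blk)` is a Steiner 2-design `S(2, μ, v)`. -/
def IsSteiner2Design {V β : Type*} [Fintype V] [DecidableEq V] [Fintype β]
    (blk : β → Finset V) (μ v : ℕ) : Prop :=
  Is2Design blk v μ 1

/-- The Tanner graph of a parity-check matrix: check vertices are rows, bit vertices are columns. -/
def tannerGraph {V β : Type*} (H : Matrix V β (ZMod 2)) : SimpleGraph (V ⊕ β) where
  Adj
    | Sum.inl p, Sum.inr b => H p b = 1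
    | Sum.inr b, Sum.inl p => H p b = 1
    | Sum.inl _, Sum.inl _ => False
    | Sum.inr _, Sum.inr _ => False
  symm := ⟨by rintro (p | b) (q | c) h <;> exact h⟩
  loopless := ⟨by rintro (p | b) h <;> exact h⟩

/-! ### Qubits and Pauli operators -/

/-- The Hilbert space `(ℂ²)^{⊗ι}` of qubits indexed by `ι`; a state is given by its amplitudes
in the computational basis, which is indexed by `ι → ZMod 2`. -/
abbrev Qubits (ι : Type*) : Type _ := EuclideanSpace ℂ (ι → ZMod 2)

/-- The Pauli operator `X^a`, which sends `|x⟩` to `|x + a⟩` (and `x - a = x + a`). -/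
def pauliX {ι : Type*} (a : ι → ZMod 2) : Module.End ℂ (Qubits ι) where
  toFun φ := WithLp.toLp 2 fun x => φ (x + a)
  map_add' _ _ := by ext; simp
  map_smul' _ _ := by ext; simp

/-- The Pauli operator `Z^a`, which sends `|x⟩` to `(-1)^{a·x} |x⟩`. -/
def pauliZ {ι : Type*} [Fintype ι] (a : ι → ZMod 2) : Module.End ℂ (Qubits ι) where
  toFun φ := WithLp.toLp 2 fun x => (-1 : ℂ) ^ (a ⬝ᵥ x).val * φ x
  map_add' _ _ := by ext; simp [mul_add]
  map_smul' _ _ := by ext; simp [mul_left_comm]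

/-! ### Entanglement-assisted quantum codes -/

/-- The tensor product of a state on `ι` and a state on `κ`. -/
def tensorState {ι κ : Type*} (ψ : Qubits ι) (φ : Qubits κ) : Qubits (ι ⊕ κ) :=
  WithLp.toLp 2 fun x => ψ (fun i => x (Sum.inl i)) * φ (fun j => x (Sum.inr j))

/-- `c` copies of the maximally entangled state `(|00⟩ + |11⟩)/√2`; the sender holds the qubits in
the left summand, the receiver those in the right one. -/
def ebits (c : ℕ) : Qubits (Fin c ⊕ Fin c) :=
  WithLp.toLp 2 fun x =>
    if (fun i => x (Sum.inl i)) = (fun i => x (Sum.inr i)) then ((√((2 : ℝ) ^ c))⁻¹ : ℝ) else 0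

/-- `E ⊗ 1` on a state of `ι ⊕ κ`: the map `E` acts on the qubits in `ι`, nothing happens to those
in `κ`. -/
def applyLeft {ι ι' κ : Type*} (E : Qubits ι → Qubits ι') (φ : Qubits (ι ⊕ κ)) :
    Qubits (ι' ⊕ κ) :=
  WithLp.toLp 2 fun x =>
    E (WithLp.toLp 2 fun y => φ (Sum.elim y fun j => x (Sum.inr j))) (fun i => x (Sum.inl i))

/-- The encoding of a `k`-qubit state `ψ`: the sender applies `E` to `ψ` and to her halves of `c`
ebits, that is, the result is `(E ⊗ 1)(ψ ⊗ Φ^{⊗c})`. -/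
def encode {β : Type*} [Fintype β] [DecidableEq β] {k c : ℕ}
    (E : Qubits (Fin k ⊕ Fin c) →ₗᵢ[ℂ] Qubits β) (ψ : Qubits (Fin k)) : Qubits (β ⊕ Fin c) :=
  applyLeft E <| WithLp.toLp 2 fun x =>
    tensorState ψ (ebits c) fun i => x ((Equiv.sumAssoc (Fin k) (Fin c) (Fin c)).symm i)

/-- `C` is (the code space of) an `[[n, k; c]]` entanglement-assisted quantum error-correcting
code on the physical qubits `β` and the receiver's `c` qubits: there are `n` physical qubits, and
`C` consists of the encodings of `k`-qubit states with the help of `c` ebits, for some isometric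
encoding (a unitary on `n` qubits with the remaining `n - k - c` inputs set to `|0⟩`). -/
def IsEAQECC {β : Type*} [Fintype β] [DecidableEq β] (n k c : ℕ)
    (C : Submodule ℂ (Qubits (β ⊕ Fin c))) : Prop :=
  Fintype.card β = n ∧
    ∃ E : Qubits (Fin k ⊕ Fin c) →ₗᵢ[ℂ] Qubits β, (C : Set (Qubits (β ⊕ Fin c))) = Set.range (encode E)

/-- The CSS generators `X^{h} ⊗ X^{a}` and `Z^{h} ⊗ Z^{b}`, where `h` runs over the rows of `H`
(acting on the physical qubits) and `a`, `b` are the corresponding rows of `A` and `B` (acting on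
the receiver's qubits). -/
def cssGenerators {V β : Type*} [Fintype β] {c : ℕ} (H : Matrix V β (ZMod 2))
    (A B : Matrix V (Fin c) (ZMod 2)) : Set (Module.End ℂ (Qubits (β ⊕ Fin c))) :=
  Set.range (fun p => pauliX (Sum.elim (H p) (A p))) ∪
    Set.range (fun p => pauliZ (Sum.elim (H p) (B p)))

/-- `C` is an `[[n, k; c]]` EAQECC obtained from the binary matrix `H` by the (entanglement-assisted)
CSS construction: the operators `X^h`, `Z^h` for the rows `h` of `H`, which need not commute, are
extended by Pauli operators on the receiver's `c` qubits to commuting operators, and `C` is the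
space that these stabilize. -/
def IsCSSEAQECC {V β : Type*} [Fintype β] [DecidableEq β] (H : Matrix V β (ZMod 2)) (n k c : ℕ)
    (C : Submodule ℂ (Qubits (β ⊕ Fin c))) : Prop :=
  IsEAQECC n k c C ∧
    ∃ A B : Matrix V (Fin c) (ZMod 2),
      (∀ g ∈ cssGenerators H A B, ∀ g' ∈ cssGenerators H A B, Commute g g') ∧
      ∀ φ, φ ∈ C ↔ ∀ g ∈ cssGenerators H A B, g φ = φ

end

/-! Commutation of the CSS generators means `A * Bᵀ = H * Hᵀ`. An encoded state is maximally
entangled with the receiver, so no nontrivial `X^d` or `Z^d` on the receiver's qubits preserves the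
code. This makes `A` and `B` injective, whence `c = rank (H * Hᵀ)`. The stabilized vectors are the
functions supported on `N = ker (H|B)` and invariant under the row space `R` of `(H|A)`. Both
extended matrices have the rank of `H`, so `k = dim N - dim R = n + c - 2 * rank H`
(`IsCSSEAQECC.parameters`). Conversely, a rank factorization of `H * Hᵀ` yields a code.

For a Steiner design, `H * Hᵀ` counts common blocks: `r = 0` on the diagonal and `1` off it. As `v -
1 = r * (μ - 1)` is even, `v` is odd and `J - I` has rank `v - 1`. Thus `rank H` is `v - 1` or `v`,
and an even `μ` excludes `v` because the rows then sum to zero. -/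

/-! ### Isometries attached to disjoint sets of equal size -/

/-- `E` sends the basis vector `w` to the normalized uniform superposition of its fibre. Disjoint
fibres give orthogonality; their common size gives the normalization. -/
theorem exists_linearIsometry_of_fibers {X W : Type*} [Fintype X] [Fintype W]
    (P : X → W → Prop) (huniq : ∀ x w w', P x w → P x w' → w = w') (m : ℕ) (hm : 0 < m)
    (hcard : ∀ w, Nat.card {x // P x w} = m) :
    ∃ E : EuclideanSpace ℂ W →ₗᵢ[ℂ] EuclideanSpace ℂ X,
      (∀ ψ x w, P x w → E ψ x = ((√(m : ℝ))⁻¹ : ℝ) * ψ w) ∧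
      ∀ ψ x, (∀ w, ¬ P x w) → E ψ x = 0 := by
  classical
  let E₀ : EuclideanSpace ℂ W →ₗ[ℂ] EuclideanSpace ℂ X :=
    { toFun := fun ψ => WithLp.toLp 2 fun x =>
        ((√(m : ℝ))⁻¹ : ℝ) * ∑ w, if P x w then ψ w else 0
      map_add' := fun ψ φ => by
        ext x
        simp [← mul_add, ← Finset.sum_add_distrib, ← ite_add_zero]
      map_smul' := fun a ψ => by
        ext x
        simp only [PiLp.smul_apply, smul_eq_mul, RingHom.id_apply, ← mul_ite_zero,
          ← Finset.mul_sum]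
        ring }
  have hsum : ∀ ψ : EuclideanSpace ℂ W, ∀ x w, P x w →
      (∑ w', if P x w' then ψ w' else 0) = ψ w := by
    intro ψ x w h
    rw [Finset.sum_eq_single w, if_pos h]
    · intro w' _ hw'
      exact if_neg fun h' => hw' (huniq x w' w h' h)
    · simp
  have hval : ∀ ψ x w, P x w → E₀ ψ x = ((√(m : ℝ))⁻¹ : ℝ) * ψ w := fun ψ x w h => by
    change _ * _ = _
    rw [hsum ψ x w h]
  have hzero : ∀ ψ x, (∀ w, ¬ P x w) → E₀ ψ x = 0 := fun ψ x h => by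
    change _ * _ = _
    rw [Finset.sum_eq_zero fun w _ => if_neg (h w), mul_zero]
  have hm' : (m : ℝ) ≠ 0 := by positivity
  have hsq : ∀ ψ x, ‖E₀ ψ x‖ ^ 2 = ∑ w, if P x w then (m : ℝ)⁻¹ * ‖ψ w‖ ^ 2 else 0 := by
    intro ψ x
    by_cases h : ∃ w, P x w
    · obtain ⟨w, hw⟩ := h
      rw [hval ψ x w hw, Finset.sum_eq_single w, if_pos hw, norm_mul, mul_pow,
        Complex.norm_real, Real.norm_eq_abs, sq_abs, inv_pow, Real.sq_sqrt (Nat.cast_nonneg m)]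
      · intro w' _ hw'
        exact if_neg fun h' => hw' (huniq x w' w h' hw)
      · simp
    · push Not at h
      rw [hzero ψ x h, Finset.sum_eq_zero fun w _ => if_neg (h w)]
      simp
  refine ⟨⟨E₀, fun ψ => ?_⟩, hval, hzero⟩
  rw [EuclideanSpace.norm_eq, EuclideanSpace.norm_eq]
  congr 1
  rw [Finset.sum_congr rfl fun x _ => hsq ψ x, Finset.sum_comm]
  refine Finset.sum_congr rfl fun w _ => ?_
  rw [← Finset.sum_filter, Finset.sum_const, nsmul_eq_mul, ← Fintype.card_subtype,
    ← Nat.card_eq_fintype_card, hcard w, mul_inv_cancel_left₀ hm']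

/-! ### The encoding map -/

theorem sum_elim_comp_inl_inr {ι κ α : Type*} (x : ι ⊕ κ → α) :
    Sum.elim (fun i => x (Sum.inl i)) (fun j => x (Sum.inr j)) = x := by
  ext (i | j) <;> rfl

theorem encode_apply {β : Type*} [Fintype β] [DecidableEq β] {k c : ℕ}
    (E : Qubits (Fin k ⊕ Fin c) →ₗᵢ[ℂ] Qubits β) (ψ : Qubits (Fin k))
    (x : β → ZMod 2) (y : Fin c → ZMod 2) :
    encode E ψ (Sum.elim x y) =
      E (WithLp.toLp 2 fun z => ψ (fun i => z (Sum.inl i)) *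
        if (fun j => z (Sum.inr j)) = y then (((√((2 : ℝ) ^ c))⁻¹ : ℝ) : ℂ) else 0) x := rfl

/-- `encode E` as a linear map. -/
noncomputable def encodeLinear {β : Type*} [Fintype β] [DecidableEq β] {k c : ℕ}
    (E : Qubits (Fin k ⊕ Fin c) →ₗᵢ[ℂ] Qubits β) :
    Qubits (Fin k) →ₗ[ℂ] Qubits (β ⊕ Fin c) where
  toFun := encode E
  map_add' ψ φ := by
    ext x
    rw [← sum_elim_comp_inl_inr x, PiLp.add_apply, encode_apply, encode_apply, encode_apply,
      ← PiLp.add_apply, ← map_add]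
    refine congrArg (fun φ => (E φ) _) (PiLp.ext fun z => ?_)
    simp only [PiLp.add_apply, add_mul]
  map_smul' a ψ := by
    ext x
    rw [← sum_elim_comp_inl_inr x, PiLp.smul_apply, encode_apply, encode_apply,
      RingHom.id_apply, ← PiLp.smul_apply, ← map_smul]
    refine congrArg (fun φ => (E φ) _) (PiLp.ext fun z => ?_)
    simp [mul_assoc]

theorem ebit_amplitude_ne_zero (c : ℕ) : (((√((2 : ℝ) ^ c))⁻¹ : ℝ) : ℂ) ≠ 0 := by
  rw [Complex.ofReal_ne_zero]
  positivity

/-- Comparing the encodings of two states for two values of the receiver's qubits. -/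
theorem eq_of_encode_slice_eq {β : Type*} [Fintype β] [DecidableEq β] {k c : ℕ}
    (E : Qubits (Fin k ⊕ Fin c) →ₗᵢ[ℂ] Qubits β) (ψ ψ' : Qubits (Fin k))
    (y y' : Fin c → ZMod 2) (a : ℂ)
    (h : ∀ x, a * encode E ψ (Sum.elim x y) = encode E ψ' (Sum.elim x y'))
    (z : Fin k → ZMod 2) (w : Fin c → ZMod 2) :
    a * (ψ z * if w = y then 1 else 0) = ψ' z * if w = y' then 1 else 0 := by
  let F : Qubits (Fin k) → (Fin c → ZMod 2) → Qubits (Fin k ⊕ Fin c) := fun ψ y =>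
    WithLp.toLp 2 fun z => ψ (fun i => z (Sum.inl i)) *
      if (fun j => z (Sum.inr j)) = y then (((√((2 : ℝ) ^ c))⁻¹ : ℝ) : ℂ) else 0
  -- Fixing the receiver's register at `y` turns `encode E ψ` into `E (F ψ y)`, so injectivity of
  -- `E` removes the encoder.
  have h1 : a • F ψ y = F ψ' y' := E.injective <| PiLp.ext fun x => by
    rw [map_smul]
    exact h x
  have h2 : a * F ψ y (Sum.elim z w) = F ψ' y' (Sum.elim z w) :=
    congrArg (fun φ : Qubits (Fin k ⊕ Fin c) => φ (Sum.elim z w)) h1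
  have h3 := ebit_amplitude_ne_zero c
  refine mul_right_cancel₀ h3 ?_
  rw [mul_assoc, mul_assoc, mul_assoc, ite_mul, ite_mul, one_mul, zero_mul]
  exact h2

theorem encode_injective {β : Type*} [Fintype β] [DecidableEq β] {k c : ℕ}
    (E : Qubits (Fin k ⊕ Fin c) →ₗᵢ[ℂ] Qubits β) : Function.Injective (encode E) := by
  intro ψ ψ' h
  ext z
  simpa using eq_of_encode_slice_eq E ψ ψ' 0 0 1 (fun x => by rw [h, one_mul]) z 0

theorem IsEAQECC.finrank_eq {β : Type*} [Fintype β] [DecidableEq β] {n k c : ℕ}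
    {C : Submodule ℂ (Qubits (β ⊕ Fin c))} (hC : IsEAQECC n k c C) :
    Module.finrank ℂ C = 2 ^ k := by
  obtain ⟨-, E, hE⟩ := hC
  have hr : C = LinearMap.range (encodeLinear E) := SetLike.coe_injective hE
  rw [hr, LinearMap.finrank_range_of_inj (encode_injective E)]
  simp [ZMod.card]

/-! ### Commutation of Pauli operators -/

theorem neg_one_pow_zmod_val_eq_one {a : ZMod 2} : (-1 : ℂ) ^ a.val = 1 ↔ a = 0 := by
  rw [neg_one_pow_eq_one_iff_even (by norm_num)]
  revert a
  decide

theorem pauliX_apply {ι : Type*} (a : ι → ZMod 2) (φ : Qubits ι) (x : ι → ZMod 2) :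
    pauliX a φ x = φ (x + a) := rfl

theorem pauliZ_apply {ι : Type*} [Fintype ι] (a : ι → ZMod 2) (φ : Qubits ι)
    (x : ι → ZMod 2) : pauliZ a φ x = (-1 : ℂ) ^ (a ⬝ᵥ x).val * φ x := rfl

theorem commute_pauliX_pauliX {ι : Type*} (a b : ι → ZMod 2) :
    Commute (pauliX a) (pauliX b) := by
  ext φ x
  simp only [Module.End.mul_apply, pauliX_apply, add_right_comm]

theorem commute_pauliZ_pauliZ {ι : Type*} [Fintype ι] (a b : ι → ZMod 2) :
    Commute (pauliZ a) (pauliZ b) := by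
  ext φ x
  simp only [Module.End.mul_apply, pauliZ_apply, mul_left_comm]

theorem commute_pauliX_pauliZ_iff {ι : Type*} [Fintype ι] {a b : ι → ZMod 2} :
    Commute (pauliX a) (pauliZ b) ↔ a ⬝ᵥ b = 0 := by
  constructor
  · intro h
    -- On the constant function at `0`, one order gives the sign `(-1)^(b·a)`, the other gives `1`.
    have h1 := congrArg (fun f : Module.End ℂ (Qubits ι) =>
      f (WithLp.toLp 2 fun _ => 1) 0) h.eq
    simp only [Module.End.mul_apply, pauliX_apply, pauliZ_apply, mul_one, zero_add,
      dotProduct_zero, ZMod.val_zero, pow_zero] at h1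
    rwa [neg_one_pow_zmod_val_eq_one, dotProduct_comm] at h1
  · intro h
    ext φ x
    simp only [Module.End.mul_apply, pauliX_apply, pauliZ_apply, dotProduct_add]
    rw [dotProduct_comm b a, h, add_zero]

/-- Only mixed X–Z pairs can fail to commute; in characteristic two the vanishing of the two summed
dot products is their equality. -/
theorem cssGenerators_commute_iff {V β : Type*} [Fintype β] {c : ℕ}
    {H : Matrix V β (ZMod 2)} {A B : Matrix V (Fin c) (ZMod 2)} :
    (∀ g ∈ cssGenerators H A B, ∀ g' ∈ cssGenerators H A B, Commute g g') ↔
      A * Bᵀ = H * Hᵀ := by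
  have key : ∀ p q, Sum.elim (H p) (A p) ⬝ᵥ Sum.elim (H q) (B q) = 0 ↔
      (A * Bᵀ) p q = (H * Hᵀ) p q := by
    intro p q
    rw [sumElim_dotProduct_sumElim, ← CharTwo.sub_eq_add, sub_eq_zero, eq_comm]
    rfl
  constructor
  · intro h
    ext p q
    exact (key p q).1 <| commute_pauliX_pauliZ_iff.1 <|
      h _ (Or.inl ⟨p, rfl⟩) _ (Or.inr ⟨q, rfl⟩)
  · intro h
    have hXZ : ∀ p q, Commute (pauliX (Sum.elim (H p) (A p)))
        (pauliZ (Sum.elim (H q) (B q))) := fun p q =>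
      commute_pauliX_pauliZ_iff.2 ((key p q).2 (by rw [h]))
    rintro _ (⟨p, rfl⟩ | ⟨p, rfl⟩) _ (⟨q, rfl⟩ | ⟨q, rfl⟩)
    · exact commute_pauliX_pauliX _ _
    · exact hXZ p q
    · exact (hXZ q p).symm
    · exact commute_pauliZ_pauliZ _ _

/-- An operator that commutes with the generators preserves the code. -/
theorem apply_mem_of_commute {V β : Type*} [Fintype β] {c : ℕ}
    {H : Matrix V β (ZMod 2)} {A B : Matrix V (Fin c) (ZMod 2)}
    {C : Submodule ℂ (Qubits (β ⊕ Fin c))}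
    (hC : ∀ φ, φ ∈ C ↔ ∀ g ∈ cssGenerators H A B, g φ = φ)
    {f : Module.End ℂ (Qubits (β ⊕ Fin c))} (hf : ∀ g ∈ cssGenerators H A B, Commute g f)
    {φ : Qubits (β ⊕ Fin c)} (hφ : φ ∈ C) : f φ ∈ C := by
  rw [hC] at hφ ⊢
  intro g hg
  rw [← Module.End.mul_apply, (hf g hg).eq, Module.End.mul_apply, hφ g hg]

theorem mulVec_injective_of_forall_eq_zero {m n : Type*} [Fintype n] {M : Matrix m n (ZMod 2)}
    (h : ∀ d, M *ᵥ d = 0 → d = 0) : Function.Injective M.mulVec := by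
  intro d d' hd
  rw [← sub_eq_zero]
  exact h _ (by rw [mulVec_sub, sub_eq_zero]; exact hd)

/-- Maximal entanglement with the receiver: no `X^d` on the receiver's qubits, `d ≠ 0`, commutes
with all generators. -/
theorem IsEAQECC.mulVec_injective_right {V β : Type*} [Fintype β] [DecidableEq β] {n k c : ℕ}
    {H : Matrix V β (ZMod 2)} {A B : Matrix V (Fin c) (ZMod 2)}
    {C : Submodule ℂ (Qubits (β ⊕ Fin c))} (hE : IsEAQECC n k c C)
    (hC : ∀ φ, φ ∈ C ↔ ∀ g ∈ cssGenerators H A B, g φ = φ) :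
    Function.Injective B.mulVec := by
  refine mulVec_injective_of_forall_eq_zero fun d hd => ?_
  obtain ⟨-, E, hE⟩ := hE
  have hf : ∀ g ∈ cssGenerators H A B, Commute g (pauliX (Sum.elim 0 d)) := by
    rintro _ (⟨p, rfl⟩ | ⟨p, rfl⟩)
    · exact commute_pauliX_pauliX _ _
    · refine (commute_pauliX_pauliZ_iff.2 ?_).symm
      rw [sumElim_dotProduct_sumElim, zero_dotProduct, zero_add, dotProduct_comm]
      exact congrFun hd p
  have hmem : ∀ ψ, encode E ψ ∈ C := fun ψ => by
    rw [← SetLike.mem_coe, hE]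
    exact ⟨ψ, rfl⟩
  have h1 := apply_mem_of_commute hC hf (hmem (WithLp.toLp 2 fun _ => 1))
  rw [← SetLike.mem_coe, hE] at h1
  obtain ⟨ψ', hψ'⟩ := h1
  -- The shift identifies slice `d` of one encoding with slice `0` of another. For `d ≠ 0` these
  -- come from inputs with disjoint supports, and comparison at `w = d` reads `1 = 0`.
  have h2 := eq_of_encode_slice_eq E (WithLp.toLp 2 fun _ => 1) ψ' d 0 1 (fun x => by
    rw [hψ', pauliX_apply, one_mul, ← Sum.elim_add_add]
    simp) 0 d
  by_contra hne
  simp [hne] at h2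

/-- The phase counterpart: `Z^d` multiplies slice `y` by `(-1)^(d·y)`, but all slices of an encoded
state carry the same `ψ`, so this sign cannot depend on `y`. -/
theorem IsEAQECC.mulVec_injective_left {V β : Type*} [Fintype β] [DecidableEq β] {n k c : ℕ}
    {H : Matrix V β (ZMod 2)} {A B : Matrix V (Fin c) (ZMod 2)}
    {C : Submodule ℂ (Qubits (β ⊕ Fin c))} (hE : IsEAQECC n k c C)
    (hC : ∀ φ, φ ∈ C ↔ ∀ g ∈ cssGenerators H A B, g φ = φ) :
    Function.Injective A.mulVec := by
  refine mulVec_injective_of_forall_eq_zero fun d hd => ?_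
  obtain ⟨-, E, hE⟩ := hE
  have hf : ∀ g ∈ cssGenerators H A B, Commute g (pauliZ (Sum.elim 0 d)) := by
    rintro _ (⟨p, rfl⟩ | ⟨p, rfl⟩)
    · refine commute_pauliX_pauliZ_iff.2 ?_
      rw [sumElim_dotProduct_sumElim, dotProduct_zero, zero_add]
      exact congrFun hd p
    · exact commute_pauliZ_pauliZ _ _
  have hmem : ∀ ψ, encode E ψ ∈ C := fun ψ => by
    rw [← SetLike.mem_coe, hE]
    exact ⟨ψ, rfl⟩
  have h1 := apply_mem_of_commute hC hf (hmem (WithLp.toLp 2 fun _ => 1))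
  rw [← SetLike.mem_coe, hE] at h1
  obtain ⟨ψ', hψ'⟩ := h1
  have h2 : ∀ y : Fin c → ZMod 2, (-1 : ℂ) ^ (d ⬝ᵥ y).val = ψ' 0 := fun y => by
    have := eq_of_encode_slice_eq E (WithLp.toLp 2 fun _ => 1) ψ' y y
      ((-1 : ℂ) ^ (d ⬝ᵥ y).val) (fun x => by
        rw [hψ', pauliZ_apply, sumElim_dotProduct_sumElim, zero_dotProduct, zero_add]) 0 y
    simpa using this
  refine dotProduct_eq_zero _ fun y => ?_
  rw [← neg_one_pow_zmod_val_eq_one, h2 y, ← h2 0, dotProduct_zero, ZMod.val_zero, pow_zero]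

/-! ### The code of functions supported on `N` and invariant under `R` -/

theorem pi_zmod_two_add_self {ι : Type*} (x : ι → ZMod 2) : x + x = 0 :=
  funext fun i => CharTwo.add_self_eq_zero (x i)

/-- Such functions live on `N / R`, whose classes `κ` labels by `k` bits. The encoder sends `|z, y⟩`
to the uniform superposition of the `x` with `(x, y) ∈ N` of class `z`. These sets are disjoint by
`hN`; by `hR` they are nonempty, hence translates of `T`. -/
theorem isEAQECC_of_support_of_invariant {β : Type*} [Fintype β] [DecidableEq β] {k c : ℕ}
    {R N : Submodule (ZMod 2) (β ⊕ Fin c → ZMod 2)} (hRN : R ≤ N)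
    (hN : ∀ x y y', Sum.elim x y ∈ N → Sum.elim x y' ∈ N → y = y')
    (hR : ∀ y, ∃ x, Sum.elim x y ∈ R)
    (hk : k + Module.finrank (ZMod 2) R = Module.finrank (ZMod 2) N)
    {C : Submodule ℂ (Qubits (β ⊕ Fin c))}
    (hC : ∀ φ, φ ∈ C ↔ (∀ x, x ∉ N → φ x = 0) ∧ ∀ a ∈ R, ∀ x, φ (x + a) = φ x) :
    IsEAQECC (Fintype.card β) k c C := by
  classical
  obtain ⟨κ, hκs, hκ⟩ : ∃ κ : N →ₗ[ZMod 2] (Fin k → ZMod 2), Function.Surjective κ ∧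
      LinearMap.ker κ = R.comap N.subtype := by
    have hfr : Module.finrank (ZMod 2) (N ⧸ R.comap N.subtype) =
        Module.finrank (ZMod 2) (Fin k → ZMod 2) := by
      have h1 := Submodule.finrank_quotient_add_finrank (R.comap N.subtype)
      rw [(Submodule.comapSubtypeEquivOfLe hRN).finrank_eq] at h1
      rw [Module.finrank_fin_fun]
      omega
    let e := LinearEquiv.ofFinrankEq _ _ hfr
    refine ⟨e.toLinearMap ∘ₗ (R.comap N.subtype).mkQ,
      e.surjective.comp (Submodule.mkQ_surjective _), ?_⟩
    rw [LinearEquiv.ker_comp, Submodule.ker_mkQ]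
  have hκeq : ∀ u u' : N, κ u = κ u' ↔ (u : β ⊕ Fin c → ZMod 2) + u' ∈ R := fun u u' => by
    rw [← sub_eq_zero, ← map_sub, ← LinearMap.mem_ker, hκ, Submodule.mem_comap, map_sub,
      sub_eq_add_neg, Submodule.subtype_apply, Submodule.subtype_apply,
      neg_eq_of_add_eq_zero_left (pi_zmod_two_add_self (u' : β ⊕ Fin c → ZMod 2))]
  let P : (β → ZMod 2) → (Fin k ⊕ Fin c → ZMod 2) → Prop := fun x w =>
    ∃ h : Sum.elim x (fun j => w (Sum.inr j)) ∈ N, κ ⟨_, h⟩ = fun i => w (Sum.inl i)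
  let T : Set (β → ZMod 2) := {x | Sum.elim x (0 : Fin c → ZMod 2) ∈ R}
  have huniq : ∀ x w w', P x w → P x w' → w = w' := by
    rintro x w w' ⟨h, hw⟩ ⟨h', hw'⟩
    have hr := hN _ _ _ h h'
    have hl : (fun i => w (Sum.inl i)) = fun i => w' (Sum.inl i) := by
      rw [← hw, ← hw']
      congr 2
      rw [hr]
    rw [← sum_elim_comp_inl_inr w, hl, hr, sum_elim_comp_inl_inr]
  have hm : 0 < Nat.card T :=
    Nat.card_pos_iff.2 ⟨⟨0, by
      change Sum.elim (0 : β → ZMod 2) (0 : Fin c → ZMod 2) ∈ R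
      convert R.zero_mem
      ext (i | i) <;> rfl⟩, inferInstance⟩
  have hcard : ∀ w, Nat.card {x // P x w} = Nat.card T := by
    intro w
    obtain ⟨u, hu⟩ := hκs fun i => w (Sum.inl i)
    -- An element of `R` that corrects the receiver's part of `u` to that of `w` without changing
    -- the class.
    obtain ⟨x₁, hx₁⟩ := hR fun j => w (Sum.inr j) + (u : β ⊕ Fin c → ZMod 2) (Sum.inr j)
    obtain ⟨x₀, hx₀⟩ : ∃ x₀, P x₀ w := by
      have hsum : Sum.elim (fun i => (u : β ⊕ Fin c → ZMod 2) (Sum.inl i) + x₁ i)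
          (fun j => w (Sum.inr j)) = (u : β ⊕ Fin c → ZMod 2) + Sum.elim x₁
            fun j => w (Sum.inr j) + (u : β ⊕ Fin c → ZMod 2) (Sum.inr j) := by
        ext (i | j)
        · simp
        · simp [add_left_comm _ (w _), CharTwo.add_self_eq_zero]
      have hmem := N.add_mem u.2 (hRN hx₁)
      rw [← hsum] at hmem
      refine ⟨_, hmem, ?_⟩
      rw [← hu, hκeq]
      change Sum.elim _ _ + _ ∈ R
      rw [hsum, add_right_comm, pi_zmod_two_add_self, zero_add]
      exact hx₁
    have hsum : ∀ x, Sum.elim (x + x₀) (0 : Fin c → ZMod 2) = Sum.elim x (fun j => w (Sum.inr j)) +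
        Sum.elim x₀ fun j => w (Sum.inr j) := fun x => by
      ext (i | j)
      · simp
      · simp [CharTwo.add_self_eq_zero]
    have hT : ∀ x, P x w ↔ x + x₀ ∈ T := by
      intro x
      change _ ↔ Sum.elim (x + x₀) (0 : Fin c → ZMod 2) ∈ R
      rw [hsum]
      constructor
      · rintro ⟨h, hw⟩
        exact (hκeq ⟨_, h⟩ ⟨_, hx₀.1⟩).1 (hw.trans hx₀.2.symm)
      · intro h
        have hmem := N.add_mem (hRN h) hx₀.1
        rw [add_assoc, pi_zmod_two_add_self, add_zero] at hmem
        exact ⟨hmem, ((hκeq ⟨_, hmem⟩ ⟨_, hx₀.1⟩).2 h).trans hx₀.2⟩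
    exact Nat.card_congr ((Equiv.addRight x₀).subtypeEquiv hT)
  obtain ⟨E, hE, hE0⟩ := exists_linearIsometry_of_fibers P huniq _ hm hcard
  refine ⟨rfl, E, ?_⟩
  set s : ℂ := (((√((Nat.card T : ℕ) : ℝ))⁻¹ : ℝ) : ℂ) with hs_def
  set t : ℂ := (((√((2 : ℝ) ^ c))⁻¹ : ℝ) : ℂ) with ht_def
  have hs : s ≠ 0 := by
    rw [hs_def, Complex.ofReal_ne_zero]
    positivity
  have ht : t ≠ 0 := ebit_amplitude_ne_zero c
  have henc : ∀ ψ (u : N), encode E ψ u = s * (ψ (κ u) * t) := by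
    intro ψ u
    have hu := sum_elim_comp_inl_inr (u : β ⊕ Fin c → ZMod 2)
    have hmem := u.2
    rw [← hu] at hmem
    rw [← hu, encode_apply, hE _ _ (Sum.elim (κ u) fun j => (u : β ⊕ Fin c → ZMod 2) (Sum.inr j))
      ⟨hmem, congrArg κ (Subtype.ext hu)⟩]
    simp [hs_def, ht_def]
  have henc0 : ∀ ψ x, x ∉ N → encode E ψ x = 0 := by
    intro ψ x hx
    rw [← sum_elim_comp_inl_inr x, encode_apply]
    by_cases h : ∃ w, P (fun i => x (Sum.inl i)) w
    · obtain ⟨w, hw⟩ := h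
      rw [hE _ _ w hw]
      -- Here `x ∉ N`: if the receiver's parts agreed, `P` would put `x` in `N`. So the ebit
      -- indicator vanishes.
      have : ¬ (fun j => w (Sum.inr j)) = fun j => x (Sum.inr j) := by
        intro hwx
        apply hx
        have := hw.1
        rwa [hwx, sum_elim_comp_inl_inr] at this
      simp [this]
    · push Not at h
      exact hE0 _ _ h
  ext φ
  rw [SetLike.mem_coe, hC]
  constructor
  · rintro ⟨hsupp, hinv⟩
    -- The preimage reads `φ` at one representative of each class and divides out both
    -- normalizations.
    refine ⟨WithLp.toLp 2 fun z => s⁻¹ * t⁻¹ * φ (Function.surjInv hκs z : N), PiLp.ext fun x => ?_⟩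
    by_cases hx : x ∈ N
    · have h1 := (hκeq (Function.surjInv hκs (κ ⟨x, hx⟩)) ⟨x, hx⟩).1
        (Function.surjInv_eq hκs _)
      have h2 := hinv _ h1 x
      rw [add_comm, add_assoc, pi_zmod_two_add_self, add_zero] at h2
      rw [henc _ ⟨x, hx⟩]
      change s * (s⁻¹ * t⁻¹ * φ _ * t) = φ x
      rw [h2]
      field_simp
    · rw [henc0 _ _ hx, hsupp x hx]
  · rintro ⟨ψ, rfl⟩
    refine ⟨henc0 ψ, fun a ha x => ?_⟩
    by_cases hx : x ∈ N
    · have hxa := N.add_mem hx (hRN ha)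
      rw [henc ψ ⟨x, hx⟩, henc ψ ⟨x + a, hxa⟩, (hκeq ⟨x + a, hxa⟩ ⟨x, hx⟩).2]
      change x + a + x ∈ R
      rwa [add_right_comm, pi_zmod_two_add_self, zero_add]
    · rw [henc0 _ _ hx, henc0]
      rwa [N.add_mem_iff_left (hRN ha)]

/-! ### CSS codes -/

theorem finrank_ker_mulVecLin_add_rank {m n : Type*} [Fintype n] (M : Matrix m n (ZMod 2)) :
    Module.finrank (ZMod 2) (LinearMap.ker M.mulVecLin) + M.rank = Fintype.card n := by
  rw [add_comm, Matrix.rank, LinearMap.finrank_range_add_finrank_ker,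
    Module.finrank_fintype_fun_eq_card]

theorem rank_eq_of_vecMul_eq_zero_iff {m n n' : Type*} [Fintype m] [Fintype n] [Fintype n']
    {M : Matrix m n (ZMod 2)} {M' : Matrix m n' (ZMod 2)}
    (h : ∀ w, w ᵥ* M = 0 ↔ w ᵥ* M' = 0) : M.rank = M'.rank := by
  rw [← rank_transpose M, ← rank_transpose M']
  have hker : LinearMap.ker Mᵀ.mulVecLin = LinearMap.ker M'ᵀ.mulVecLin := by
    ext w
    simpa [mulVec_transpose] using h w
  have h1 := finrank_ker_mulVecLin_add_rank Mᵀ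
  have h2 := finrank_ker_mulVecLin_add_rank M'ᵀ
  rw [hker] at h1
  omega

theorem vecMul_surjective_of_mulVec_injective {m n : Type*} [Fintype m] [Fintype n]
    {M : Matrix m n (ZMod 2)} (h : Function.Injective M.mulVec) :
    Function.Surjective M.vecMul := by
  have h1 : Mᵀ.rank = Fintype.card n := by
    rw [rank_transpose, Matrix.rank, LinearMap.finrank_range_of_inj h,
      Module.finrank_fintype_fun_eq_card]
  have h2 : LinearMap.range Mᵀ.mulVecLin = ⊤ :=
    Submodule.eq_top_of_finrank_eq (h1.trans (Module.finrank_fintype_fun_eq_card _).symm)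
  intro d
  obtain ⟨w, hw⟩ := LinearMap.range_eq_top.1 h2 d
  exact ⟨w, by rw [← hw, mulVecLin_apply, mulVec_transpose]⟩

/-- Adjoining `A` keeps every row relation: `wH = 0` gives `wABᵀ = wHHᵀ = 0`, hence `wA = 0` since
`B` is injective. -/
theorem rank_fromCols_of_mul_transpose_eq {V β : Type*} [Fintype V] [Fintype β] {c : ℕ}
    {H : Matrix V β (ZMod 2)} {A B : Matrix V (Fin c) (ZMod 2)} (hAB : A * Bᵀ = H * Hᵀ)
    (hB : Function.Injective B.mulVec) : (fromCols H A).rank = H.rank := by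
  refine rank_eq_of_vecMul_eq_zero_iff fun w => ?_
  rw [vecMul_fromCols]
  constructor
  · intro h
    exact funext fun i => congrFun h (Sum.inl i)
  · intro h
    have h1 : B *ᵥ (w ᵥ* A) = B *ᵥ 0 := by
      rw [mulVec_zero, ← vecMul_transpose, vecMul_vecMul, hAB, ← vecMul_vecMul, h, zero_vecMul]
    rw [h, hB h1]
    ext (i | i) <;> rfl

/-! ### The stabilized space and the resulting parameters. -/

theorem fixed_pauliZ_iff {ι : Type*} [Fintype ι] {a : ι → ZMod 2} {φ : Qubits ι} :
    pauliZ a φ = φ ↔ ∀ x, a ⬝ᵥ x ≠ 0 → φ x = 0 := by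
  constructor
  · intro h x hx
    have h1 := congrArg (fun ψ : Qubits ι => ψ x) h
    simp only [pauliZ_apply] at h1
    by_contra hne
    exact hx (neg_one_pow_zmod_val_eq_one.1 (mul_eq_right₀ hne |>.1 h1))
  · intro h
    refine PiLp.ext fun x => ?_
    rw [pauliZ_apply]
    by_cases hx : a ⬝ᵥ x = 0
    · rw [hx, ZMod.val_zero, pow_zero, one_mul]
    · rw [h x hx, mul_zero]

/-- Z generators restrict the support; X generators impose invariance under translation, which
passes from rows to their span. -/
theorem fixed_cssGenerators_iff {V β : Type*} [Fintype β] {c : ℕ}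
    {H : Matrix V β (ZMod 2)} {A B : Matrix V (Fin c) (ZMod 2)} {φ : Qubits (β ⊕ Fin c)} :
    (∀ g ∈ cssGenerators H A B, g φ = φ) ↔
      (∀ x, x ∉ LinearMap.ker (fromCols H B).mulVecLin → φ x = 0) ∧
      ∀ a ∈ Submodule.span (ZMod 2) (Set.range (fromCols H A).row), ∀ x, φ (x + a) = φ x := by
  constructor
  · intro h
    constructor
    · intro x hx
      obtain ⟨p, hp⟩ : ∃ p, Sum.elim (H p) (B p) ⬝ᵥ x ≠ 0 := by
        by_contra! hne
        exact hx (LinearMap.mem_ker.2 (funext hne))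
      exact fixed_pauliZ_iff.1 (h _ (Or.inr ⟨p, rfl⟩)) x hp
    · intro a ha
      induction ha using Submodule.span_induction with
      | mem a ha =>
        obtain ⟨p, rfl⟩ := ha
        exact fun x => congrArg (fun ψ : Qubits (β ⊕ Fin c) => ψ x) (h _ (Or.inl ⟨p, rfl⟩))
      | zero => exact fun x => by rw [add_zero]
      | add a b _ _ ha hb => exact fun x => by rw [← add_assoc, hb, ha]
      | smul r a _ ha =>
        intro x
        obtain rfl | rfl : r = 0 ∨ r = 1 := by
          revert r
          decide
        · rw [zero_smul, add_zero]
        · rw [one_smul, ha]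
  · rintro ⟨hsupp, hinv⟩ _ (⟨p, rfl⟩ | ⟨p, rfl⟩)
    · exact PiLp.ext fun x => hinv _ (Submodule.subset_span ⟨p, rfl⟩) x
    · exact fixed_pauliZ_iff.2 fun x hx => hsupp x fun hmem =>
        hx (congrFun (LinearMap.mem_ker.1 hmem) p)

/-- The parameters of the CSS code with maximal entanglement. -/
theorem exists_isEAQECC_of_fixed {V β : Type*} [Fintype V] [Fintype β] [DecidableEq β] {c : ℕ}
    {H : Matrix V β (ZMod 2)} {A B : Matrix V (Fin c) (ZMod 2)} (hAB : A * Bᵀ = H * Hᵀ)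
    (hA : Function.Injective A.mulVec) (hB : Function.Injective B.mulVec)
    {C : Submodule ℂ (Qubits (β ⊕ Fin c))}
    (hC : ∀ φ, φ ∈ C ↔ ∀ g ∈ cssGenerators H A B, g φ = φ) :
    ∃ k, k + 2 * H.rank = Fintype.card β + c ∧ IsEAQECC (Fintype.card β) k c C := by
  have hBA : B * Aᵀ = H * Hᵀ := by
    rw [← transpose_transpose (B * Aᵀ), transpose_mul, transpose_transpose, hAB, transpose_mul,
      transpose_transpose]
  have hRN : Submodule.span (ZMod 2) (Set.range (fromCols H A).row) ≤
      LinearMap.ker (fromCols H B).mulVecLin := by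
    rw [Submodule.span_le]
    rintro _ ⟨p, rfl⟩
    refine LinearMap.mem_ker.2 (funext fun q => ?_)
    change Sum.elim (H q) (B q) ⬝ᵥ Sum.elim (H p) (A p) = 0
    rw [sumElim_dotProduct_sumElim, ← CharTwo.sub_eq_add, sub_eq_zero]
    exact (congrFun (congrFun hBA q) p).symm
  have hr1 : Module.finrank (ZMod 2) (Submodule.span (ZMod 2) (Set.range (fromCols H A).row)) =
      H.rank := by
    rw [← rank_eq_finrank_span_row, rank_fromCols_of_mul_transpose_eq hAB hB]
  have hr2 : Module.finrank (ZMod 2) (LinearMap.ker (fromCols H B).mulVecLin) + H.rank =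
      Fintype.card β + c := by
    rw [← rank_fromCols_of_mul_transpose_eq hBA hA, finrank_ker_mulVecLin_add_rank,
      Fintype.card_sum, Fintype.card_fin]
  obtain ⟨k, hk⟩ := Nat.exists_eq_add_of_le' (Submodule.finrank_mono hRN)
  refine ⟨k, by omega, isEAQECC_of_support_of_invariant hRN ?_ ?_ hk.symm
    fun φ => (hC φ).trans fixed_cssGenerators_iff⟩
  · intro x y y' h h'
    rw [LinearMap.mem_ker, mulVecLin_apply, fromCols_mulVec_sumElim] at h h'
    exact hB (add_left_cancel (h.trans h'.symm))
  · intro y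
    obtain ⟨w, hw⟩ := vecMul_surjective_of_mulVec_injective hA y
    refine ⟨w ᵥ* H, ?_⟩
    rw [← range_vecMulLinear]
    exact ⟨w, by rw [← hw, vecMulLinear_apply, vecMul_fromCols]⟩

theorem IsCSSEAQECC.parameters {V β : Type*} [Fintype V] [Fintype β] [DecidableEq β]
    {H : Matrix V β (ZMod 2)} {n k c : ℕ} {C : Submodule ℂ (Qubits (β ⊕ Fin c))}
    (h : IsCSSEAQECC H n k c C) :
    n = Fintype.card β ∧ c = (H * Hᵀ).rank ∧ k + 2 * H.rank = n + c := by
  obtain ⟨hE, A, B, hcomm, hC⟩ := h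
  have hAB := cssGenerators_commute_iff.1 hcomm
  have hA := hE.mulVec_injective_left hC
  have hB := hE.mulVec_injective_right hC
  obtain ⟨k', hk', hE'⟩ := exists_isEAQECC_of_fixed hAB hA hB hC
  -- `C` has dimension both `2 ^ k` and `2 ^ k'`.
  have hkk : k = k' := Nat.pow_right_injective le_rfl (hE.finrank_eq.symm.trans hE'.finrank_eq)
  refine ⟨hE.1.symm, ?_, by rw [hkk, hk', hE.1]⟩
  have hrange : LinearMap.range Bᵀ.mulVecLin = ⊤ := LinearMap.range_eq_top.2 fun d => by
    obtain ⟨w, hw⟩ := vecMul_surjective_of_mulVec_injective hB d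
    exact ⟨w, by rw [← hw, mulVecLin_apply, mulVec_transpose]⟩
  rw [← hAB, Matrix.rank, mulVecLin_mul, LinearMap.range_comp_of_range_eq_top _ hrange,
    LinearMap.finrank_range_of_inj hA, Module.finrank_fin_fun]

/-- A factorization of `H * Hᵀ` through injective matrices yields a code. -/
theorem exists_isCSSEAQECC {V β : Type*} [Fintype V] [Fintype β] [DecidableEq β] {c : ℕ}
    {H : Matrix V β (ZMod 2)} {A B : Matrix V (Fin c) (ZMod 2)} (hAB : A * Bᵀ = H * Hᵀ)
    (hA : Function.Injective A.mulVec) (hB : Function.Injective B.mulVec) :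
    ∃ (n k c : ℕ) (C : Submodule ℂ (Qubits (β ⊕ Fin c))), IsCSSEAQECC H n k c C := by
  let C : Submodule ℂ (Qubits (β ⊕ Fin c)) :=
    ⨅ g ∈ cssGenerators H A B, LinearMap.eqLocus g LinearMap.id
  have hC : ∀ φ, φ ∈ C ↔ ∀ g ∈ cssGenerators H A B, g φ = φ := fun φ => by
    simp [C, Submodule.mem_iInf, LinearMap.mem_eqLocus]
  obtain ⟨k, -, hE⟩ := exists_isEAQECC_of_fixed hAB hA hB hC
  exact ⟨_, k, c, C, hE, A, B, cssGenerators_commute_iff.2 hAB, hC⟩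

/-- The columns of `A` are a basis of the column space of `M`; row `q` of `B` holds the coordinates
of column `q` of `M`. -/
theorem exists_rank_factorization {V : Type*} [Fintype V] (M : Matrix V V (ZMod 2)) :
    ∃ A B : Matrix V (Fin M.rank) (ZMod 2), A * Bᵀ = M ∧
      Function.Injective A.mulVec ∧ Function.Injective B.mulVec := by
  classical
  let b : Module.Basis (Fin M.rank) (ZMod 2) (LinearMap.range M.mulVecLin) :=
    Module.finBasis (ZMod 2) _
  let A : Matrix V (Fin M.rank) (ZMod 2) := Matrix.of fun p i => (b i : V → ZMod 2) p
  let B : Matrix V (Fin M.rank) (ZMod 2) := Matrix.of fun q i =>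
    b.repr ⟨M.mulVecLin (Pi.single q 1), LinearMap.mem_range_self _ _⟩ i
  have hA : ∀ d, A *ᵥ d = ((∑ i, d i • b i : LinearMap.range M.mulVecLin) : V → ZMod 2) := by
    intro d
    ext p
    simp [A, mulVec, dotProduct, mul_comm]
  have hAB : A * Bᵀ = M := by
    ext p q
    change (A *ᵥ B q) p = _
    rw [hA]
    have h := b.sum_repr ⟨M.mulVecLin (Pi.single q 1), LinearMap.mem_range_self _ _⟩
    change ((∑ i, b.repr _ i • b i : LinearMap.range M.mulVecLin) : V → ZMod 2) p = _
    rw [h]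
    simp
  refine ⟨A, B, hAB, mulVec_injective_of_forall_eq_zero fun d hd => ?_, ?_⟩
  · rw [hA, ZeroMemClass.coe_eq_zero] at hd
    exact funext (Fintype.linearIndependent_iff.1 b.linearIndependent d hd)
  -- `rank B ≥ rank M`, the number of columns of `B`, so the kernel is trivial.
  · have h1 := rank_mul_le_right A Bᵀ
    rw [hAB, rank_transpose] at h1
    have h2 := finrank_ker_mulVecLin_add_rank B
    rw [Fintype.card_fin] at h2
    have h3 : LinearMap.ker B.mulVecLin = ⊥ := Submodule.finrank_eq_zero.1 (by omega)
    exact LinearMap.ker_eq_bot.1 h3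

/-- Every binary matrix has a corresponding entanglement-assisted code. -/
theorem exists_isCSSEAQECC_of_matrix {V β : Type*} [Fintype V] [Fintype β] [DecidableEq β]
    (H : Matrix V β (ZMod 2)) :
    ∃ (n k c : ℕ) (C : Submodule ℂ (Qubits (β ⊕ Fin c))), IsCSSEAQECC H n k c C := by
  obtain ⟨A, B, hAB, hA, hB⟩ := exists_rank_factorization (H * Hᵀ)
  exact exists_isCSSEAQECC hAB hA hB

/-! ### The rank of `J - 1` -/

/-- A kernel vector is constant, equal to its own coordinate sum; for odd `card V` every constant
qualifies, so the kernel is a line. -/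
theorem rank_allOne_sub_one {V : Type*} [Fintype V] [DecidableEq V]
    (hV : Odd (Fintype.card V)) :
    (Matrix.of (fun _ _ => 1) - 1 : Matrix V V (ZMod 2)).rank = Fintype.card V - 1 := by
  have hmul : ∀ x : V → ZMod 2, (Matrix.of (fun _ _ => 1) - 1 : Matrix V V (ZMod 2)) *ᵥ x =
      (fun _ => ∑ q, x q) - x := fun x => by
    rw [sub_mulVec, one_mulVec]
    congr 1
    ext p
    simp [mulVec, dotProduct]
  have hker : LinearMap.ker (Matrix.of (fun _ _ => 1) - 1 : Matrix V V (ZMod 2)).mulVecLin =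
      Submodule.span (ZMod 2) {fun _ => 1} := by
    ext x
    rw [LinearMap.mem_ker, mulVecLin_apply, hmul, sub_eq_zero, Submodule.mem_span_singleton]
    constructor
    · intro h
      exact ⟨∑ q, x q, (funext fun _ => mul_one _).trans h⟩
    · rintro ⟨a, rfl⟩
      ext
      simp [ZMod.natCast_eq_one_iff_odd.2 hV]
  have hne : (fun _ : V => (1 : ZMod 2)) ≠ 0 := fun h => by
    obtain ⟨p⟩ := Fintype.card_pos_iff.1 hV.pos
    exact one_ne_zero (congrFun h p)
  have h := finrank_ker_mulVecLin_add_rank (Matrix.of (fun _ _ => 1) - 1 : Matrix V V (ZMod 2))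
  rw [hker, finrank_span_singleton hne] at h
  omega

/-! ### Steiner designs -/

theorem incidenceMatrix_apply {V β : Type*} [DecidableEq V] (blk : β → Finset V) (p : V) (b : β) :
    incidenceMatrix blk p b = if p ∈ blk b then 1 else 0 := rfl

theorem incidenceMatrix_ne_zero_iff {V β : Type*} [DecidableEq V] {blk : β → Finset V} {p : V}
    {b : β} : incidenceMatrix blk p b ≠ 0 ↔ p ∈ blk b := by
  simp [incidenceMatrix_apply]

theorem incidenceMatrix_eq_one_iff {V β : Type*} [DecidableEq V] {blk : β → Finset V} {p : V}
    {b : β} : incidenceMatrix blk p b = 1 ↔ p ∈ blk b := by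
  simp [incidenceMatrix_apply]

section Steiner

variable {V β : Type*} [Fintype V] [DecidableEq V] [Fintype β] {blk : β → Finset V} {μ v : ℕ}

/-- The number of blocks through a point. -/
theorem IsSteiner2Design.card_blocks_through (hS : IsSteiner2Design blk μ v) (p : V) :
    (Finset.univ.filter fun b => p ∈ blk b).card * (μ - 1) = v - 1 := by
  classical
  -- Double count of pairs `(q, b)` with `q ≠ p` and both points on `b`.
  have h := Finset.sum_card_bipartiteAbove_eq_sum_card_bipartiteBelow
    (s := Finset.univ.erase p) (t := Finset.univ.filter fun b => p ∈ blk b)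
    (fun q b => q ∈ blk b)
  rw [Finset.sum_congr rfl (g := fun _ => 1), Finset.sum_congr rfl (g := fun _ => μ - 1)
    (s₁ := Finset.univ.filter fun b => p ∈ blk b), Finset.sum_const, Finset.sum_const,
    Finset.card_erase_of_mem (Finset.mem_univ p), Finset.card_univ, hS.card_points] at h
  · simpa using h.symm
  · intro b hb
    rw [← hS.card_block b, ← Finset.card_erase_of_mem (Finset.mem_filter.1 hb).2]
    congr 1
    ext q
    simp [Finset.mem_bipartiteBelow]
  · intro q hq
    rw [← hS.card_pair p q (Finset.ne_of_mem_erase hq).symm]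
    congr 1
    ext b
    simp [Finset.mem_bipartiteAbove]

theorem IsSteiner2Design.sum_card_blocks_through (hS : IsSteiner2Design blk μ v) :
    ∑ p, (Finset.univ.filter fun b => p ∈ blk b).card = Fintype.card β * μ := by
  have h := Finset.sum_card_bipartiteAbove_eq_sum_card_bipartiteBelow
    (s := Finset.univ) (t := Finset.univ) (fun (p : V) (b : β) => p ∈ blk b)
  refine h.trans ?_
  rw [Finset.sum_congr rfl (g := fun _ => μ), Finset.sum_const, Finset.card_univ, smul_eq_mul]
  intro b _
  rw [← hS.card_block b]
  congr 1
  ext q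
  simp [Finset.mem_bipartiteBelow]

theorem IsSteiner2Design.exists_block (hS : IsSteiner2Design blk μ v) {p q : V} (hpq : p ≠ q) :
    ∃ b, p ∈ blk b ∧ q ∈ blk b := by
  obtain ⟨b, hb⟩ := Finset.card_pos.1 ((hS.card_pair p q hpq).symm ▸ Nat.one_pos)
  exact ⟨b, (Finset.mem_filter.1 hb).2⟩

theorem IsSteiner2Design.block_unique (hS : IsSteiner2Design blk μ v) {p q : V} (hpq : p ≠ q)
    {b b' : β} (hp : p ∈ blk b) (hq : q ∈ blk b) (hp' : p ∈ blk b') (hq' : q ∈ blk b') :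
    b = b' :=
  Finset.card_le_one.1 (hS.card_pair p q hpq).le b (by simp [hp, hq]) b' (by simp [hp', hq'])

/-- A triangle: three points that pairwise span distinct blocks. -/
theorem IsSteiner2Design.exists_triangle (hS : IsSteiner2Design blk μ v) (hμ : 2 ≤ μ)
    (hμv : μ < v) :
    ∃ (p q s : V) (b₁ b₂ b₃ : β), p ≠ q ∧ q ≠ s ∧ s ≠ p ∧ b₁ ≠ b₂ ∧ b₂ ≠ b₃ ∧ b₃ ≠ b₁ ∧
      (p ∈ blk b₁ ∧ q ∈ blk b₁) ∧ (q ∈ blk b₂ ∧ s ∈ blk b₂) ∧ (s ∈ blk b₃ ∧ p ∈ blk b₃) := by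
  obtain ⟨p, q, hpq⟩ := Fintype.exists_pair_of_one_lt_card (α := V)
    (by rw [hS.card_points]; omega)
  obtain ⟨b₁, hp1, hq1⟩ := hS.exists_block hpq
  obtain ⟨s, hs⟩ : ∃ s, s ∉ blk b₁ := by
    by_contra! h
    have h1 := hS.card_block b₁
    rw [Finset.eq_univ_iff_forall.2 h, Finset.card_univ, hS.card_points] at h1
    omega
  have hqs : q ≠ s := fun h => hs (h ▸ hq1)
  have hsp : s ≠ p := fun h => hs (h ▸ hp1)
  obtain ⟨b₂, hq2, hs2⟩ := hS.exists_block hqs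
  obtain ⟨b₃, hs3, hp3⟩ := hS.exists_block hsp
  refine ⟨p, q, s, b₁, b₂, b₃, hpq, hqs, hsp, ?_, ?_, ?_, ⟨hp1, hq1⟩, ⟨hq2, hs2⟩, hs3, hp3⟩
  · rintro rfl
    exact hs hs2
  · rintro rfl
    -- A common block for the last two sides contains `p` and `q`, so it is `b₁`, which misses `s`.
    exact hs (hS.block_unique hpq hp1 hq1 hp3 hq2 ▸ hs2)
  · rintro rfl
    exact hs hs3

theorem IsSteiner2Design.incidenceMatrix_mul_transpose (hS : IsSteiner2Design blk μ v) {r : ℕ}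
    (hr : ∀ p, (Finset.univ.filter fun b => p ∈ blk b).card = r) (hreven : Even r) :
    incidenceMatrix blk * (incidenceMatrix blk)ᵀ = Matrix.of (fun _ _ => 1) - 1 := by
  ext p q
  have h : (incidenceMatrix blk * (incidenceMatrix blk)ᵀ) p q =
      ((Finset.univ.filter fun b => p ∈ blk b ∧ q ∈ blk b).card : ZMod 2) := by
    simp [mul_apply, incidenceMatrix_apply, ← ite_and, and_comm]
  rw [h]
  by_cases hpq : p = q
  · subst hpq
    simp [hr p, (ZMod.natCast_eq_zero_iff_even).2 hreven]
  · simp [hS.card_pair p q hpq, one_apply_ne hpq]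

/-- Columns of even weight put the all-one vector in the left kernel. -/
theorem IsSteiner2Design.rank_incidenceMatrix_lt (hS : IsSteiner2Design blk μ v) (hv : 0 < v)
    (hμ : Even μ) : (incidenceMatrix blk).rank < v := by
  have h := finrank_ker_mulVecLin_add_rank (incidenceMatrix blk)ᵀ
  rw [rank_transpose, hS.card_points] at h
  have hmem : (fun _ => 1) ∈ LinearMap.ker (incidenceMatrix blk)ᵀ.mulVecLin := by
    rw [LinearMap.mem_ker]
    refine funext fun b => ?_
    change ∑ p, incidenceMatrix blk p b * 1 = 0
    simp [incidenceMatrix_apply, hS.card_block, (ZMod.natCast_eq_zero_iff_even).2 hμ]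
  have hpos : 0 < Module.finrank (ZMod 2) (LinearMap.ker (incidenceMatrix blk)ᵀ.mulVecLin) := by
    refine Nat.pos_of_ne_zero fun h0 => ?_
    rw [Submodule.finrank_eq_zero] at h0
    rw [h0, Submodule.mem_bot] at hmem
    obtain ⟨p⟩ := Fintype.card_pos_iff.1 (hS.card_points.symm ▸ hv)
    exact one_ne_zero (congrFun hmem p)
  omega

/-! ### The girth of the Tanner graph -/

/-- The two-colouring of the Tanner graph by checks and bits. -/
def tannerColoring {V β : Type*} (H : Matrix V β (ZMod 2)) : (tannerGraph H).Coloring Bool :=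
  SimpleGraph.Coloring.mk Sum.isLeft fun {x y} h => by
    rcases x with p | b <;> rcases y with q | c <;> first | exact h.elim | simp

/-- Two blocks sharing two points coincide, so every closed walk of length four degenerates. -/
theorem IsSteiner2Design.tannerGraph_no_four_cycle (hS : IsSteiner2Design blk μ v)
    {x y z w : V ⊕ β} (h1 : (tannerGraph (incidenceMatrix blk)).Adj x y)
    (h2 : (tannerGraph (incidenceMatrix blk)).Adj y z)
    (h3 : (tannerGraph (incidenceMatrix blk)).Adj z w)
    (h4 : (tannerGraph (incidenceMatrix blk)).Adj w x) : x = z ∨ y = w := by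
  have key : ∀ (p q : V) (b b' : β), incidenceMatrix blk p b = 1 → incidenceMatrix blk q b = 1 →
      incidenceMatrix blk q b' = 1 → incidenceMatrix blk p b' = 1 → p = q ∨ b = b' := by
    simp only [incidenceMatrix_eq_one_iff]
    intro p q b b' hp hq hq' hp'
    by_cases hpq : p = q
    · exact Or.inl hpq
    · exact Or.inr (hS.block_unique hpq hp hq hp' hq')
  rcases x with p | b <;> rcases y with q | c <;> try exact h1.elim
  · rcases z with q | d <;> try exact h2.elim
    rcases w with q' | d <;> try exact h3.elim
    simpa using key p q c d h1 h2 h3 h4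
  · rcases z with q' | d <;> try exact h2.elim
    rcases w with q' | d' <;> try exact h3.elim
    simpa [or_comm] using key q q' b d h1 h4 h3 h2

/-- A triangle of the design is a 6-cycle; bipartiteness leaves only length four to exclude below
six. -/
theorem IsSteiner2Design.egirth_tannerGraph (hS : IsSteiner2Design blk μ v) (hμ : 2 ≤ μ)
    (hμv : μ < v) : (tannerGraph (incidenceMatrix blk)).egirth = 6 := by
  apply le_antisymm
  · obtain ⟨p, q, s, b₁, b₂, b₃, hpq, hqs, hsp, h12, h23, h31, ⟨hp1, hq1⟩, ⟨hq2, hs2⟩, hs3, hp3⟩ :=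
      hS.exists_triangle hμ hμv
    have e1 : (tannerGraph (incidenceMatrix blk)).Adj (Sum.inl p) (Sum.inr b₁) :=
      incidenceMatrix_eq_one_iff.2 hp1
    have e2 : (tannerGraph (incidenceMatrix blk)).Adj (Sum.inr b₁) (Sum.inl q) :=
      incidenceMatrix_eq_one_iff.2 hq1
    have e3 : (tannerGraph (incidenceMatrix blk)).Adj (Sum.inl q) (Sum.inr b₂) :=
      incidenceMatrix_eq_one_iff.2 hq2
    have e4 : (tannerGraph (incidenceMatrix blk)).Adj (Sum.inr b₂) (Sum.inl s) :=
      incidenceMatrix_eq_one_iff.2 hs2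
    have e5 : (tannerGraph (incidenceMatrix blk)).Adj (Sum.inl s) (Sum.inr b₃) :=
      incidenceMatrix_eq_one_iff.2 hs3
    have e6 : (tannerGraph (incidenceMatrix blk)).Adj (Sum.inr b₃) (Sum.inl p) :=
      incidenceMatrix_eq_one_iff.2 hp3
    refine SimpleGraph.egirth_le_length
      (w := .cons e1 (.cons e2 (.cons e3 (.cons e4 (.cons e5 (.cons e6 .nil)))))) ?_
    rw [SimpleGraph.Walk.cons_isCycle_iff]
    simp [SimpleGraph.Walk.isPath_def, hpq, hpq.symm, hqs, hsp, hsp.symm, h12, h23, h31.symm]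
  · rw [SimpleGraph.le_egirth]
    intro a w hw
    by_contra! hlt
    have hlt' : w.length < 6 := by exact_mod_cast hlt
    have h3 := hw.three_le_length
    have heven : Even w.length := ((tannerColoring _).even_length_iff_congr w).2 Iff.rfl
    have h4 : w.length = 4 := by
      obtain ⟨m, hm⟩ := heven
      omega
    have hadj : ∀ i < 4, (tannerGraph (incidenceMatrix blk)).Adj (w.getVert i)
        (w.getVert (i + 1)) := fun i hi => w.adj_getVert_succ (h4 ▸ hi)
    have hclose : w.getVert 4 = w.getVert 0 := by
      rw [w.getVert_zero, ← h4, w.getVert_length]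
    rcases hS.tannerGraph_no_four_cycle (hadj 0 (by norm_num)) (hadj 1 (by norm_num))
      (hadj 2 (by norm_num)) (hclose ▸ hadj 3 (by norm_num)) with h | h
    · have := hw.getVert_injOn' (by simp) (by simp [h4]) h
      omega
    · have := hw.getVert_injOn' (by simp [h4]) (by simp [h4]) h
      omega

end Steiner

/-! ### The parameters for a Steiner design. -/

theorem mainTheorem6 {V β : Type*} [Fintype V] [DecidableEq V] [Fintype β] [DecidableEq β]
    (blk : β → Finset V) (v μ r : ℕ) (hS : IsSteiner2Design blk μ v)
    (hμ : 2 ≤ μ) (hμv : μ < v)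
    (hr : (r : ℚ) = ((v : ℚ) - 1) / ((μ : ℚ) - 1)) (hreven : Even r)
    (H : Matrix V β (ZMod 2)) (hH : H = incidenceMatrix blk) :
    (∀ p, hammingNorm (H p) = r) ∧
    (∀ b, hammingNorm (Hᵀ b) = μ) ∧
    (tannerGraph H).egirth = 6 ∧
    H * Hᵀ = Matrix.of (fun _ _ => 1) - 1 ∧
    (∃ (n k c : ℕ) (C : Submodule ℂ (Qubits (β ⊕ Fin c))), IsCSSEAQECC H n k c C) ∧
    ∀ (n k c : ℕ) (C : Submodule ℂ (Qubits (β ⊕ Fin c))), IsCSSEAQECC H n k c C →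
      (n : ℚ) = (v : ℚ) * ((v : ℚ) - 1) / ((μ : ℚ) * ((μ : ℚ) - 1)) ∧
      (Even μ → (k : ℚ) = (v : ℚ) * r / μ - v + 1) ∧
      (Odd μ → (k : ℚ) = (v : ℚ) * r / μ - v + 1 ∨ (k : ℚ) = (v : ℚ) * r / μ - v - 1) ∧
      (c : ℚ) = (v : ℚ) - 1 := by
  subst hH
  have hμ0 : (μ : ℚ) ≠ 0 := by positivity
  have hμ2 : (2 : ℚ) ≤ μ := by exact_mod_cast hμ
  have hμ1 : (μ : ℚ) - 1 ≠ 0 := by linarith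
  have hrv : r * (μ - 1) = v - 1 := by
    rw [eq_div_iff hμ1] at hr
    have : ((r * (μ - 1) : ℕ) : ℚ) = (v - 1 : ℕ) := by
      rw [Nat.cast_mul, Nat.cast_sub (by omega), Nat.cast_sub (by omega), Nat.cast_one, hr]
    exact_mod_cast this
  have hdeg : ∀ p, (Finset.univ.filter fun b => p ∈ blk b).card = r := fun p =>
    Nat.eq_of_mul_eq_mul_right (by omega) ((hS.card_blocks_through p).trans hrv.symm)
  have hHH := hS.incidenceMatrix_mul_transpose hdeg hreven
  have hodd : Odd v := by
    have h1 : Even (v - 1) := hrv ▸ hreven.mul_right _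
    obtain ⟨m, hm⟩ := h1
    exact ⟨m, by omega⟩
  have hrank : (incidenceMatrix blk * (incidenceMatrix blk)ᵀ).rank = v - 1 := by
    rw [hHH, rank_allOne_sub_one (hS.card_points.symm ▸ hodd), hS.card_points]
  have hrank_ge : v - 1 ≤ (incidenceMatrix blk).rank := hrank ▸ rank_mul_le_left _ _
  have hrank_le : (incidenceMatrix blk).rank ≤ v :=
    hS.card_points ▸ rank_le_card_height (incidenceMatrix blk)
  have hcount : v * r = Fintype.card β * μ := by
    rw [← hS.sum_card_blocks_through, Finset.sum_congr rfl fun p _ => hdeg p, Finset.sum_const,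
      Finset.card_univ, hS.card_points, smul_eq_mul]
  have hcard : (Fintype.card β : ℚ) = (v : ℚ) * r / μ := by
    rw [eq_div_iff hμ0]
    exact_mod_cast hcount.symm
  refine ⟨fun p => ?_, fun b => ?_, hS.egirth_tannerGraph hμ hμv, hHH,
    exists_isCSSEAQECC_of_matrix _, fun n k c C hC => ?_⟩
  · simpa only [hammingNorm, incidenceMatrix_ne_zero_iff] using hdeg p
  · simp only [hammingNorm, transpose_apply, incidenceMatrix_ne_zero_iff]
    simpa using hS.card_block b
  · obtain ⟨hn, hc, hk⟩ := hC.parameters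
    rw [hrank] at hc
    have hkv : ∀ s : ℕ, (incidenceMatrix blk).rank = s →
        (k : ℚ) = (v : ℚ) * r / μ + ((v : ℚ) - 1) - 2 * s := by
      intro s hs
      rw [hs, hn, hc] at hk
      have hk' : (k : ℚ) + 2 * s = Fintype.card β + ((v - 1 : ℕ) : ℚ) := by exact_mod_cast hk
      rw [Nat.cast_sub (by omega), Nat.cast_one] at hk'
      rw [← hcard]
      linarith
    have hlow : (incidenceMatrix blk).rank = v - 1 → (k : ℚ) = (v : ℚ) * r / μ - v + 1 := by
      intro h
      rw [hkv _ h, Nat.cast_sub (by omega), Nat.cast_one]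
      ring
    refine ⟨?_, fun hev => hlow ?_, fun _ => ?_, ?_⟩
    · rw [hn, hcard, hr]
      field_simp
    · have := hS.rank_incidenceMatrix_lt (by omega) hev
      omega
    -- For odd `μ` both ranks `v` and `v - 1` remain possible, whence two values of `k`.
    · by_cases h : (incidenceMatrix blk).rank = v
      · right
        rw [hkv _ h]
        ring
      · exact Or.inl (hlow (by omega))
    · rw [hc, Nat.cast_sub (by omega), Nat.cast_one]
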